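/- Let $p,q,n$ be positive integers with $p<q\le n/2$. Let $\alpha,\beta,x_0,\dots,x_{n-1}$ be independent indeterminates, and let $y_0,y_1,\dots$ be the sequence in the field of rational functions $\mathbb{Q}(\alpha,\beta,x_0,\dots,x_{n-1})$ with $y_i=x_i$ for $0\le i<n$ and $$y_{k+n}=\frac{\alpha\, y_{k+p}\,y_{k+n-p}+\beta\, y_{k+q}\,y_{k+n-q}}{y_k}\qquad (k\ge 0).$$ Then for every $m\ge 0$ the term $y_m$ is nonzero (so that all the divisions make sense), and $y_m$ is a Laurent polynomial in the initial terms $y_0,\dots,y_{n-1}$ with coefficients in $\mathbb{Z}[\alpha,\beta]$: there is $L_m\in\mathbb{Z}[\alpha,\beta][x_0^{\pm1},\dots,x_{n-1}^{\pm1}]$ with $y_m=L_m(\alpha,\beta;x_0,\dots,x_{n-1})$. Moreover, the same $L_m$ expresses the $m$-th term as a function of the initial terms for every choice of the parameters: if $K$ is a field, $a,b\in K$, and $z_0,z_1,\dots$ is a sequence of nonzero elements of $K$ satisfying the recurrence with $\alpha=a$, $\beta=b$, then $z_m=L_m(a,b;z_0,\dots,z_{n-1})$. In particular, taking $a=b=1$,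 $p=1$, $q=2$ and $n=4$ (resp. $n=5$), this covers the Somos-4 (resp. Somos-5) recurrence. -/

import Mathlib

universe u

/-- The Laurent polynomial ring `R[x_0^{±1}, …, x_{n-1}^{±1}]`: finitely supported `R`-linear
combinations of monomials `x^e`, one for each exponent vector `e : Fin n → ℤ`. -/
abbrev LaurentPoly (R : Type*) [CommRing R] (n : ℕ) : Type _ := AddMonoidAlgebra R (Fin n → ℤ)

/-- The value of a Laurent polynomial with coefficients in `ℤ[α, β]` (the polynomial ring in the
two variables `α = X 0` and `β = X 1`) at `α = a`, `β = b`, `x_i = x i`, in a field `K`.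
It is meaningful when all `x i` are nonzero. -/
noncomputable def LaurentPoly.value {n : ℕ} (L : LaurentPoly (MvPolynomial (Fin 2) ℤ) n)
    {K : Type*} [Field K] (a b : K) (x : Fin n → K) : K :=
  ∑ e ∈ L.coeff.support, MvPolynomial.aeval ![a, b] (L.coeff e) * ∏ i, x i ^ e i

/-- The field `ℚ(α, β, x_0, …, x_{n-1})` of rational functions, as the fraction field of
`ℤ[α, β, x_0, …, x_{n-1}]`. -/
abbrev RatFunField (n : ℕ) : Type := FractionRing (MvPolynomial (Fin 2 ⊕ Fin n) ℤ)

/-- The indeterminate `α`. -/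
noncomputable def RatFunField.α (n : ℕ) : RatFunField n :=
  algebraMap (MvPolynomial (Fin 2 ⊕ Fin n) ℤ) (RatFunField n) (MvPolynomial.X (Sum.inl 0))

/-- The indeterminate `β`. -/
noncomputable def RatFunField.β (n : ℕ) : RatFunField n :=
  algebraMap (MvPolynomial (Fin 2 ⊕ Fin n) ℤ) (RatFunField n) (MvPolynomial.X (Sum.inl 1))

/-- The indeterminate `x_i`. -/
noncomputable def RatFunField.x {n : ℕ} (i : Fin n) : RatFunField n :=
  algebraMap (MvPolynomial (Fin 2 ⊕ Fin n) ℤ) (RatFunField n) (MvPolynomial.X (Sum.inr i))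

/-- The sequence `y_0, y_1, …` in the field `K` satisfies the two-term Gale-Robinson recurrence
`y_{k+n} = (a y_{k+p} y_{k+n-p} + b y_{k+q} y_{k+n-q}) / y_k` for all `k ≥ 0`
(to be used with `p, q ≤ n` and, for the division, with `y_k ≠ 0`). -/
def IsTwoTermGaleRobinson {K : Type*} [Field K] (n p q : ℕ) (a b : K) (y : ℕ → K) : Prop :=
  ∀ k : ℕ, y (k + n) =
    (a * y (k + p) * y (k + n - p) + b * y (k + q) * y (k + n - q)) / y k

/-!
Let `Λ` be the ring of Laurent polynomials over `ℤ[α, β]` and suppose that `y_0, …, y_{m-1}` lie in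
`Λ`. If `0 < s` and `s + n ≤ m`, then `y_m` is, by the same formula that expresses `y_{m-s}` in
`y_0, …, y_{n-1}`, a Laurent polynomial in the window `y_s, …, y_{s+n-1}`. For `m > 2n` the window
`s = 1` shows `y_m ∈ Λ[1/y_n]`, as `y_1, …, y_{n-1}` are units, and the window `s = n + 1` writes
`y_m` with a denominator that is a product of `y_{n+1}, …, y_{2n}`. Now `y_n` is prime in `Λ`,
being a monomial times `α + β x^e`, and it divides none of `y_{n+1}, …, y_{2n}`: the specialization
`α = 1`, `β = 2`, `x_p = -2`, `x_i = 1` (`i ≠ p`) kills `y_n`, while a parity argument shows that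
it kills none of the others. Hence `y_m ∈ Λ`.
-/

section Recurrence

variable {R S : Type*} [CommRing R] [CommRing S] {n p q m : ℕ} {a b : R} {y z : ℕ → R}

/-- The numerator of `y_{k+n}` in the Gale-Robinson recurrence. -/
def galeRobinsonNum (n p q : ℕ) (a b : R) (y : ℕ → R) (k : ℕ) : R :=
  a * y (k + p) * y (k + n - p) + b * y (k + q) * y (k + n - q)

/-- The sequence `y` in the commutative ring `R` satisfies, in division-free form, those instances
of the Gale-Robinson recurrence that involve only terms of index less than `m`. -/
def GaleRobinsonBelow (n p q m : ℕ) (a b : R) (y : ℕ → R) : Prop :=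
  ∀ k, k + n < m → y (k + n) * y k = galeRobinsonNum n p q a b y k

theorem map_galeRobinsonNum (f : R →+* S) (n p q : ℕ) (a b : R) (y : ℕ → R) (k : ℕ) :
    f (galeRobinsonNum n p q a b y k) = galeRobinsonNum n p q (f a) (f b) (fun i => f (y i)) k := by
  simp only [galeRobinsonNum, map_add, map_mul]

theorem galeRobinsonNum_shift (hpn : p ≤ n) (hqn : q ≤ n) (a b : R) (y : ℕ → R) (s k : ℕ) :
    galeRobinsonNum n p q a b (fun i => y (s + i)) k = galeRobinsonNum n p q a b y (s + k) := by
  have hp : p ≤ k + n := by omega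
  have hq : q ≤ k + n := by omega
  simp only [galeRobinsonNum, ← Nat.add_sub_assoc hp, ← Nat.add_sub_assoc hq, ← add_assoc]

theorem galeRobinsonNum_congr (hp : 0 < p) (hpn : p < n) (hq : 0 < q) (hqn : q < n) {k : ℕ}
    (h : ∀ i < k + n, y i = z i) :
    galeRobinsonNum n p q a b y k = galeRobinsonNum n p q a b z k := by
  rw [galeRobinsonNum, h _ (by omega), h _ (by omega), h (k + q) (by omega),
    h (k + n - q) (by omega), galeRobinsonNum]

theorem galeRobinson_induction {P : ℕ → Prop} (init : ∀ i < n, P i)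
    (step : ∀ k, k + n < m → (∀ i < k + n, P i) → P (k + n)) : ∀ i < m, P i := by
  intro i
  induction i using Nat.strong_induction_on with
  | _ i ih =>
    intro him
    obtain hin | hni := lt_or_ge i n
    · exact init i hin
    · obtain ⟨k, rfl⟩ := Nat.exists_eq_add_of_le' hni
      exact step k him fun j hj => ih j hj (hj.trans him)

theorem IsTwoTermGaleRobinson.below {K : Type*} [Field K] {a b : K} {y : ℕ → K}
    (h : IsTwoTermGaleRobinson n p q a b y) (hy : ∀ k, k + n < m → y k ≠ 0) :
    GaleRobinsonBelow n p q m a b y := fun k hk => by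
  rw [h k, div_mul_cancel₀ _ (hy k hk), galeRobinsonNum]

namespace GaleRobinsonBelow

theorem mul_eq (h : GaleRobinsonBelow n p q m a b y) (k : ℕ) {l i j i' j' : ℕ} (hm : k + n < m)
    (hl : k + n = l) (hi : k + p = i) (hj : k + n - p = j) (hi' : k + q = i')
    (hj' : k + n - q = j') : y l * y k = a * y i * y j + b * y i' * y j' := by
  subst hl hi hj hi' hj'
  exact h k hm

theorem mono {l : ℕ} (h : GaleRobinsonBelow n p q m a b y) (hlm : l ≤ m) :
    GaleRobinsonBelow n p q l a b y := fun k hk => h k (hk.trans_le hlm)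

theorem map (h : GaleRobinsonBelow n p q m a b y) (f : R →+* S) :
    GaleRobinsonBelow n p q m (f a) (f b) (fun i => f (y i)) := fun k hk => by
  rw [← map_mul, h k hk, map_galeRobinsonNum]

theorem shift (h : GaleRobinsonBelow n p q m a b y) (hpn : p ≤ n) (hqn : q ≤ n) (s : ℕ) :
    GaleRobinsonBelow n p q (m - s) a b (fun i => y (s + i)) := fun k hk => by
  rw [galeRobinsonNum_shift hpn hqn, ← h (s + k) (by omega), add_assoc]

theorem update (h : GaleRobinsonBelow n p q m a b y) (hp : 0 < p) (hpn : p < n) (hq : 0 < q)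
    (hqn : q < n) {k : ℕ} (hk : k + n = m) {c : R}
    (hc : c * y k = galeRobinsonNum n p q a b y k) :
    GaleRobinsonBelow n p q (m + 1) a b (Function.update y m c) := by
  intro i hi
  have update_eq {j : ℕ} (hj : j < m) : Function.update y m c j = y j :=
    Function.update_of_ne hj.ne _ _
  rw [galeRobinsonNum_congr hp hpn hq hqn fun j hj => update_eq (by omega),
    update_eq (by omega : i < m)]
  obtain hi' | hi' := (Nat.lt_succ_iff.mp hi).lt_or_eq
  · rw [update_eq hi', h i hi']
  · obtain rfl : i = k := by omega
    rw [hi', Function.update_self, hc]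

/-- Cancellation of `y_k` in the recurrence determines each term from the earlier ones. -/
theorem eq_of_init [IsDomain R] (hy : GaleRobinsonBelow n p q m a b y)
    (hz : GaleRobinsonBelow n p q m a b z) (hp : 0 < p) (hpn : p < n) (hq : 0 < q) (hqn : q < n)
    (hinit : ∀ i < n, y i = z i) (hne : ∀ k, k + n < m → z k ≠ 0) : ∀ i < m, y i = z i :=
  galeRobinson_induction hinit fun k hk ih => by
    refine mul_right_cancel₀ (hne k hk) ?_
    rw [hz k hk, ← galeRobinsonNum_congr hp hpn hq hqn ih, ← hy k hk, ih k (by omega)]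

theorem pos [LinearOrder R] [IsStrictOrderedRing R] (h : GaleRobinsonBelow n p q m a b y)
    (hp : 0 < p) (hpn : p < n) (hq : 0 < q) (hqn : q < n) (ha : 0 < a) (hb : 0 < b)
    (hinit : ∀ i < n, 0 < y i) : ∀ i < m, 0 < y i :=
  galeRobinson_induction hinit fun k hk ih => by
    refine pos_of_mul_pos_left ?_ (ih k (by omega)).le
    have := ih (k + p) (by omega)
    have := ih (k + n - p) (by omega)
    have := ih (k + q) (by omega)
    have := ih (k + n - q) (by omega)
    rw [h k hk, galeRobinsonNum]
    positivity

end GaleRobinsonBelow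

end Recurrence

section Cofactor

variable {R S : Type*} [CommRing R] [CommRing S] {n p q m : ℕ} {a b : R} {y z : ℕ → R}

/-- The cofactor of `y_n` in the numerator of `y_{2n}`, once that numerator is multiplied by
`y_p y_{n-p} y_q y_{n-q}`. -/
def galeRobinsonCofactor (n p q : ℕ) (a b : R) (y : ℕ → R) : R :=
  a * (y q * y (n - q)) * (a ^ 2 * y (2 * p) * y (2 * n - 2 * p) * y n +
      a * b * (y (2 * p) * (y (n + q - p) * y (2 * n - p - q)) +
        y (2 * n - 2 * p) * (y (p + q) * y (n + p - q)))) +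
    b * (y p * y (n - p)) * (b ^ 2 * y (2 * q) * y (2 * n - 2 * q) * y n +
      a * b * (y (2 * q) * (y (n + p - q) * y (2 * n - p - q)) +
        y (2 * n - 2 * q) * (y (p + q) * y (n + q - p)))) +
    a * b * y 0 * (y (p + q) * y (n + p - q) * y (n + q - p) * y (2 * n - p - q))

theorem map_galeRobinsonCofactor (f : R →+* S) (n p q : ℕ) (a b : R) (y : ℕ → R) :
    f (galeRobinsonCofactor n p q a b y) =
      galeRobinsonCofactor n p q (f a) (f b) (fun i => f (y i)) := by
  simp only [galeRobinsonCofactor, map_add, map_mul, map_pow]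

theorem galeRobinsonCofactor_congr (hp : 0 < p) (hpq : p < q) (hqn : 2 * q ≤ n)
    (h : ∀ i < 2 * n, y i = z i) :
    galeRobinsonCofactor n p q a b y = galeRobinsonCofactor n p q a b z := by
  simp (disch := omega) only [galeRobinsonCofactor, h]

/-- Expanding `y_{n+p}`, `y_{2n-p}`, `y_{n+q}`, `y_{2n-q}` leaves, modulo `y_n`, a multiple of
`a y_p y_{n-p} + b y_q y_{n-q} = y_n y_0`. -/
theorem GaleRobinsonBelow.galeRobinsonNum_mul_eq (h : GaleRobinsonBelow n p q m a b y)
    (hm : 2 * n ≤ m) (hp : 0 < p) (hpq : p < q) (hqn : 2 * q ≤ n) :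
    galeRobinsonNum n p q a b y n * (y p * y (n - p) * (y q * y (n - q))) =
      y n * galeRobinsonCofactor n p q a b y := by
  have h_n : y n * y 0 = a * y p * y (n - p) + b * y q * y (n - q) := by
    apply h.mul_eq <;> omega
  have h_add_p : y (n + p) * y p = a * y (2 * p) * y n + b * y (p + q) * y (n + p - q) := by
    apply h.mul_eq <;> omega
  have h_sub_p : y (2 * n - p) * y (n - p) =
      a * y n * y (2 * n - 2 * p) + b * y (n + q - p) * y (2 * n - p - q) := by
    apply h.mul_eq <;> omega
  have h_add_q : y (n + q) * y q = a * y (p + q) * y (n + q - p) + b * y (2 * q) * y n := by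
    apply h.mul_eq <;> omega
  have h_sub_q : y (2 * n - q) * y (n - q) =
      a * y (n + p - q) * y (2 * n - p - q) + b * y n * y (2 * n - 2 * q) := by
    apply h.mul_eq <;> omega
  rw [galeRobinsonNum, galeRobinsonCofactor, ← two_mul]
  linear_combination
    a * (y q * y (n - q)) * (h_add_p * (y (2 * n - p) * y (n - p)) +
      (a * y (2 * p) * y n + b * y (p + q) * y (n + p - q)) * h_sub_p) +
    b * (y p * y (n - p)) * (h_add_q * (y (2 * n - q) * y (n - q)) +
      (a * y (p + q) * y (n + q - p) + b * y (2 * q) * y n) * h_sub_q) -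
    a * b * (y (p + q) * y (n + p - q) * y (n + q - p) * y (2 * n - p - q)) * h_n

end Cofactor

section Parity

variable {n p q : ℕ}

theorem galeRobinsonCofactor_ne_zero_of_odd {c : ℕ → ℤ} (hp : 0 < p) (hpq : p < q)
    (hqn : 2 * q ≤ n) (hcn : c n = 0)
    (hodd : ∀ i < 2 * n, i ∉ ({p, n, 2 * n - p} : Finset ℕ) → Odd (c i)) :
    galeRobinsonCofactor n p q 1 2 c ≠ 0 := by
  have odd_of {i : ℕ} (hi : i < 2 * n) (h : i ≠ p ∧ i ≠ n ∧ i ≠ 2 * n - p) : Odd (c i) :=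
    hodd i hi (by simpa using h)
  have h_zero : Odd (c 0) := odd_of (by omega) (by omega)
  have h₁ : Odd (c (2 * p)) := odd_of (by omega) (by omega)
  have h₂ : Odd (c (2 * n - 2 * p)) := odd_of (by omega) (by omega)
  have h₃ : Odd (c (n + q - p)) := odd_of (by omega) (by omega)
  have h₄ : Odd (c (2 * n - p - q)) := odd_of (by omega) (by omega)
  have h₅ : Odd (c (p + q)) := odd_of (by omega) (by omega)
  have h₆ : Odd (c (n + p - q)) := odd_of (by omega) (by omega)
  obtain ⟨d, hd⟩ : Odd
      (c q * c (n - q) * (c (2 * p) * (c (n + q - p) * c (2 * n - p - q)) +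
        c (2 * n - 2 * p) * (c (p + q) * c (n + p - q))) +
      2 * (c p * c (n - p) * (c (2 * q) * (c (n + p - q) * c (2 * n - p - q)) +
        c (2 * n - 2 * q) * (c (p + q) * c (n + q - p)))) +
      c 0 * (c (p + q) * c (n + p - q) * c (n + q - p) * c (2 * n - p - q))) :=
    (((h₁.mul (h₃.mul h₄)).add_odd (h₂.mul (h₅.mul h₆))).mul_left _ |>.add
      (even_two_mul _)).add_odd (h_zero.mul (((h₅.mul h₆).mul h₃).mul h₄))
  have cofactor_eq : galeRobinsonCofactor n p q 1 2 c = 2 * (2 * d + 1) := by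
    rw [galeRobinsonCofactor, hcn, ← hd]
    ring
  omega

namespace GaleRobinsonBelow

theorem apply_n_eq_zero {v : ℕ → ℚ} (h : GaleRobinsonBelow n p q (2 * n) 1 2 v) (hp : 0 < p)
    (hpq : p < q) (hqn : 2 * q ≤ n) (hinit : ∀ i < n, v i = if i = p then -2 else 1) :
    v n = 0 := by
  have h_n : v n * v 0 = 1 * v p * v (n - p) + 2 * v q * v (n - q) := by
    apply h.mul_eq <;> omega
  rw [hinit 0 (by omega), hinit p (by omega), hinit (n - p) (by omega), hinit q (by omega),
    hinit (n - q) (by omega), if_neg (by omega), if_pos rfl, if_neg (by omega), if_neg (by omega),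
    if_neg (by omega)] at h_n
  linarith

/-- The division by `v_p = -2` in `v_{p+n}` is exact, as the first summand of its numerator
contains `v_n = 0` and `b = 2` divides the second. -/
theorem exists_odd_int {v : ℕ → ℚ} (h : GaleRobinsonBelow n p q (2 * n) 1 2 v) (hp : 0 < p)
    (hpq : p < q) (hqn : 2 * q ≤ n) (hinit : ∀ i < n, v i = if i = p then -2 else 1) :
    ∃ c : ℕ → ℤ, ∀ i < 2 * n, v i = c i ∧ (i ∉ ({p, n, 2 * n - p} : Finset ℕ) → Odd (c i)) := by
  have key : ∀ i < 2 * n, ∃ c : ℤ, v i = c ∧ (i ∉ ({p, n, 2 * n - p} : Finset ℕ) → Odd c) := by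
    refine galeRobinson_induction (n := n) (fun i hi => ?_) fun k hk ih => ?_
    · rw [hinit i hi]
      split_ifs with hip
      · exact ⟨-2, by norm_num, by simp [hip]⟩
      · exact ⟨1, by norm_num, fun _ => odd_one⟩
    obtain ⟨c₁, hc₁, odd₁⟩ := ih (k + p) (by omega)
    obtain ⟨c₂, hc₂, odd₂⟩ := ih (k + n - p) (by omega)
    obtain ⟨c₃, hc₃, odd₃⟩ := ih (k + q) (by omega)
    obtain ⟨c₄, hc₄, odd₄⟩ := ih (k + n - q) (by omega)
    simp only [Finset.mem_insert, Finset.mem_singleton, not_or] at odd₁ odd₂ odd₃ odd₄ ⊢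
    have hrec := h k hk
    rw [hinit k (by omega), galeRobinsonNum, hc₁, hc₂, hc₃, hc₄] at hrec
    split_ifs at hrec with hkp
    · subst hkp
      have hc₂_zero : (c₂ : ℚ) = 0 := by
        rw [← hc₂, Nat.add_sub_cancel_left, h.apply_n_eq_zero hp hpq hqn hinit]
      refine ⟨-(c₃ * c₄), ?_, fun _ => ((odd₃ (by omega)).mul (odd₄ (by omega))).neg⟩
      rw [hc₂_zero] at hrec
      push_cast
      linarith
    · refine ⟨c₁ * c₂ + 2 * (c₃ * c₄), ?_, fun hk' => ?_⟩
      · push_cast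
        linarith
      · exact ((odd₁ (by omega)).mul (odd₂ (by omega))).add_even (even_two_mul _)
  choose! c hc using key
  exact ⟨c, hc⟩

theorem galeRobinsonCofactor_ne_zero {v : ℕ → ℚ} (h : GaleRobinsonBelow n p q (2 * n) 1 2 v)
    (hp : 0 < p) (hpq : p < q) (hqn : 2 * q ≤ n) (hinit : ∀ i < n, v i = if i = p then -2 else 1) :
    galeRobinsonCofactor n p q 1 2 v ≠ 0 := by
  obtain ⟨c, hc⟩ := h.exists_odd_int hp hpq hqn hinit
  have hcn : c n = 0 := by
    exact_mod_cast (hc n (by omega)).1.symm.trans (h.apply_n_eq_zero hp hpq hqn hinit)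
  have cast_cofactor := map_galeRobinsonCofactor (Int.castRingHom ℚ) n p q 1 2 c
  rw [map_one, map_ofNat] at cast_cofactor
  rw [galeRobinsonCofactor_congr hp hpq hqn fun i hi => (hc i hi).1]
  refine cast_cofactor.symm.trans_ne (Int.cast_ne_zero.2 ?_)
  exact galeRobinsonCofactor_ne_zero_of_odd hp hpq hqn hcn fun i hi => (hc i hi).2

theorem apply_ne_zero {v : ℕ → ℚ} (h : GaleRobinsonBelow n p q (2 * n) 1 2 v) (hp : 0 < p)
    (hpq : p < q) (hqn : 2 * q ≤ n) (hinit : ∀ i < n, v i = if i = p then -2 else 1) {i : ℕ}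
    (hni : n < i) (hi : i < 2 * n) : v i ≠ 0 := by
  obtain ⟨c, hc⟩ := h.exists_odd_int hp hpq hqn hinit
  have ne_zero_of {i : ℕ} (hi : i < 2 * n) (hi' : i ≠ p ∧ i ≠ n ∧ i ≠ 2 * n - p) : v i ≠ 0 := by
    rw [(hc i hi).1, Int.cast_ne_zero]
    exact fun h0 => Int.not_odd_zero (h0 ▸ (hc i hi).2 (by simpa using hi'))
  by_cases hip : i = 2 * n - p
  · have h_sub_p : v (2 * n - p) * v (n - p) =
        1 * v n * v (2 * n - 2 * p) + 2 * v (n + q - p) * v (2 * n - p - q) := by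
      apply h.mul_eq <;> omega
    rw [h.apply_n_eq_zero hp hpq hqn hinit, mul_zero, zero_mul, zero_add, ← hip] at h_sub_p
    refine left_ne_zero_of_mul (h_sub_p ▸ mul_ne_zero (mul_ne_zero two_ne_zero ?_) ?_)
    · exact ne_zero_of (by omega) (by omega)
    · exact ne_zero_of (by omega) (by omega)
  · exact ne_zero_of hi (by omega)

end GaleRobinsonBelow

end Parity

local notation "Λ" => LaurentPoly (MvPolynomial (Fin 2) ℤ)

namespace LaurentPoly

variable {n : ℕ} {S : Type*} [CommRing S]

/-- The constant Laurent polynomial `α` (for `i = 0`) or `β` (for `i = 1`). -/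
noncomputable def param (n : ℕ) (i : Fin 2) : Λ n :=
  AddMonoidAlgebra.single 0 (MvPolynomial.X i)

/-- The Laurent monomial `x^e`, as a unit. -/
noncomputable def monomial : Multiplicative (Fin n → ℤ) →* (Λ n)ˣ :=
  (AddMonoidAlgebra.of (MvPolynomial (Fin 2) ℤ) (Fin n → ℤ)).toHomUnits

/-- The variable `x_i`, as a unit. -/
noncomputable def var (i : Fin n) : (Λ n)ˣ :=
  monomial (.ofAdd (Pi.single i 1))

theorem monomial_eq_prod (e : Multiplicative (Fin n → ℤ)) :
    monomial e = ∏ i, var i ^ e.toAdd i := by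
  simp only [var, ← map_zpow, ← map_prod, ← ofAdd_zsmul, ← ofAdd_sum, ← Pi.single_smul,
    smul_eq_mul, mul_one, Finset.univ_sum_single, ofAdd_toAdd]

theorem ringHom_ext {f g : Λ n →+* S} (h₀ : f (param n 0) = g (param n 0))
    (h₁ : f (param n 1) = g (param n 1)) (hvar : ∀ i : Fin n, f (var i) = g (var i)) : f = g := by
  refine AddMonoidAlgebra.ringHom_ext (fun r => ?_) fun e => ?_
  · have hcoeff : f.comp AddMonoidAlgebra.singleZeroRingHom =
        g.comp AddMonoidAlgebra.singleZeroRingHom :=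
      MvPolynomial.ringHom_ext' (Subsingleton.elim _ _) (Fin.forall_fin_two.2 ⟨h₀, h₁⟩)
    exact DFunLike.congr_fun hcoeff r
  · have hvar' (i : Fin n) : Units.map (f : Λ n →* S) (var i) = Units.map (g : Λ n →* S) (var i) :=
      Units.ext (hvar i)
    have hmon : Units.map (f : Λ n →* S) (monomial (.ofAdd e)) =
        Units.map (g : Λ n →* S) (monomial (.ofAdd e)) := by
      simp only [monomial_eq_prod, map_prod, map_zpow, hvar']
    exact congrArg Units.val hmon

/-- Evaluation at `α = a`, `β = b` and units `x_i` of a commutative ring. -/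
noncomputable def eval (a b : S) (x : Fin n → Sˣ) : Λ n →+* S :=
  AddMonoidAlgebra.liftNCRingHom (MvPolynomial.aeval ![a, b]).toRingHom
    ((Units.coeHom S).comp
      { toFun := fun e => ∏ i, x i ^ e.toAdd i
        map_one' := by simp
        map_mul' := fun e f => by simp [zpow_add, Finset.prod_mul_distrib] })
    fun _ _ => Commute.all _ _

theorem eval_single (a b : S) (x : Fin n → Sˣ) (e : Fin n → ℤ) (r : MvPolynomial (Fin 2) ℤ) :
    eval a b x (AddMonoidAlgebra.single e r) =
      MvPolynomial.aeval ![a, b] r * ((∏ i, x i ^ e i : Sˣ) : S) :=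
  AddMonoidAlgebra.liftNCRingHom_single _ _ _ _ _

theorem eval_param (a b : S) (x : Fin n → Sˣ) (i : Fin 2) :
    eval a b x (param n i) = ![a, b] i := by
  simp [param, eval_single]

theorem eval_monomial (a b : S) (x : Fin n → Sˣ) (e : Multiplicative (Fin n → ℤ)) :
    eval a b x (monomial e) = ((∏ i, x i ^ e.toAdd i : Sˣ) : S) := by
  refine (eval_single a b x e.toAdd 1).trans ?_
  rw [map_one, one_mul]

theorem eval_var (a b : S) (x : Fin n → Sˣ) (i : Fin n) : eval a b x (var i) = x i := by
  rw [var, eval_monomial, toAdd_ofAdd, Fintype.prod_eq_single i fun j hj => ?_, Pi.single_eq_same,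
    zpow_one]
  rw [Pi.single_eq_of_ne hj, zpow_zero]

theorem eval_eq_value {K : Type*} [Field K] (a b : K) (x : Fin n → Kˣ) (L : Λ n) :
    eval a b x L = L.value a b fun i => x i := by
  conv_lhs => rw [← AddMonoidAlgebra.sum_coeff_single L]
  rw [Finsupp.sum, map_sum, value]
  refine Finset.sum_congr rfl fun e _ => ?_
  rw [eval_single]
  push_cast
  rfl

/-- `α + β x^e` generates the kernel of the substitution `α ↦ -β x^e`. -/
theorem prime_param_add_param_mul_monomial (e : Multiplicative (Fin n → ℤ)) :
    Prime (param n 0 + param n 1 * monomial e) := by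
  set u : Λ n := param n 0 + param n 1 * monomial e with hu
  let φ : Λ n →+* Λ n := eval (-(param n 1 * monomial e)) (param n 1) var
  have φ_α : φ (param n 0) = -(param n 1 * monomial e) := eval_param _ _ _ _
  have φ_β : φ (param n 1) = param n 1 := eval_param _ _ _ _
  have φ_monomial : φ (monomial e) = monomial e :=
    (eval_monomial _ _ _ e).trans (congrArg _ (monomial_eq_prod _).symm)
  have φ_u : φ u = 0 := by
    rw [hu, map_add, map_mul, φ_α, φ_β, φ_monomial, neg_add_cancel]
  have mk_comp : (Ideal.Quotient.mk (Ideal.span {u})).comp φ = Ideal.Quotient.mk _ := by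
    refine ringHom_ext ?_ (congrArg _ φ_β) fun i => congrArg _ (eval_var _ _ _ i)
    rw [RingHom.comp_apply, φ_α, Ideal.Quotient.eq, Ideal.mem_span_singleton]
    exact ⟨-1, by rw [hu]; ring⟩
  have ker_φ : RingHom.ker φ = Ideal.span {u} := by
    refine le_antisymm (fun L hL => ?_) ((Ideal.span_singleton_le_iff_mem _).2 φ_u)
    rw [← Ideal.Quotient.eq_zero_iff_mem, ← mk_comp, RingHom.comp_apply, RingHom.mem_ker.1 hL,
      map_zero]
  have u_ne_zero : u ≠ 0 := fun h => by
    have u_eval := congrArg (eval (1 : ℤ) 1 1) h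
    rw [hu, map_add, map_mul, eval_param, eval_param, eval_monomial, map_zero] at u_eval
    simp at u_eval
  exact (Ideal.span_singleton_prime u_ne_zero).1 (ker_φ ▸ RingHom.ker_isPrime φ)

/-- The inclusion of `ℤ[α, β, x_0, …, x_{n-1}]` into the Laurent polynomials. -/
noncomputable def ofMvPolynomial (n : ℕ) : MvPolynomial (Fin 2 ⊕ Fin n) ℤ →+* Λ n :=
  (MvPolynomial.aeval (Sum.elim (param n) fun i => (var i : Λ n))).toRingHom

theorem ofMvPolynomial_X (i : Fin 2 ⊕ Fin n) :
    ofMvPolynomial n (.X i) = Sum.elim (param n) (fun i => (var i : Λ n)) i :=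
  MvPolynomial.aeval_X _ _

end LaurentPoly

open LaurentPoly

theorem dvd_of_dvd_prime_pow_mul_of_dvd_mul {R : Type*} [CommRing R] [IsDomain R] {π s d r : R}
    (hπ : Prime π) (hs : ¬ π ∣ s) {k : ℕ} (hd_pow : d ∣ π ^ k * r) (hd : d ∣ s * r) : d ∣ r := by
  obtain ⟨u, hu⟩ := hd_pow
  obtain ⟨v, hv⟩ := hd
  obtain rfl | hd0 := eq_or_ne d 0
  · rw [zero_mul] at hu
    rw [(mul_eq_zero.1 hu).resolve_left (pow_ne_zero k hπ.ne_zero)]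
  have hsu : s * u = π ^ k * v := mul_left_cancel₀ hd0 (by linear_combination π ^ k * hv - s * hu)
  obtain ⟨w, rfl⟩ := hπ.pow_dvd_of_dvd_mul_left k hs ⟨v, hsu⟩
  exact ⟨w, mul_left_cancel₀ (pow_ne_zero k hπ.ne_zero) (by linear_combination hu)⟩

/-- The terms `L_0, …, L_{m-1}` are those of the Gale-Robinson sequence with parameters `α`, `β`
and initial terms `x_0, …, x_{n-1}`, and they are Laurent polynomials; the terms `L_i` with
`m ≤ i` and `n ≤ i` are arbitrary. -/
structure IsGenericGaleRobinson (n p q m : ℕ) (L : ℕ → Λ n) : Prop where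
  init : ∀ i : Fin n, L i = var i
  below : GaleRobinsonBelow n p q m (param n 0) (param n 1) L

namespace IsGenericGaleRobinson

variable {n p q m k : ℕ} {L : ℕ → Λ n} {S : Type*} [CommRing S] {a b : S} {x : Fin n → Sˣ}

theorem mono {l : ℕ} (h : IsGenericGaleRobinson n p q m L) (hlm : l ≤ m) :
    IsGenericGaleRobinson n p q l L :=
  ⟨h.init, h.below.mono hlm⟩

theorem isUnit (h : IsGenericGaleRobinson n p q m L) {i : ℕ} (hi : i < n) : IsUnit (L i) :=
  h.init ⟨i, hi⟩ ▸ (var ⟨i, hi⟩).isUnit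

theorem eval_init (h : IsGenericGaleRobinson n p q m L) (i : Fin n) :
    eval a b x (L i) = x i := by
  rw [h.init, eval_var]

theorem eval_below (h : IsGenericGaleRobinson n p q m L) :
    GaleRobinsonBelow n p q m a b fun i => eval a b x (L i) := by
  have := h.below.map (eval a b x)
  rwa [eval_param, eval_param] at this

theorem eval_eq [IsDomain S] (h : IsGenericGaleRobinson n p q m L) (hp : 0 < p) (hpq : p < q)
    (hqn : 2 * q ≤ n) {z : ℕ → S} (hz : GaleRobinsonBelow n p q m a b z)
    (hinit : ∀ i : Fin n, z i = x i) (hne : ∀ k, k + n < m → z k ≠ 0) :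
    ∀ i < m, eval a b x (L i) = z i :=
  h.eval_below.eq_of_init hz hp (by omega) (by omega) (by omega)
    (fun i hi => (h.eval_init ⟨i, hi⟩).trans (hinit ⟨i, hi⟩).symm) hne

theorem ne_zero (h : IsGenericGaleRobinson n p q m L) (hp : 0 < p) (hpq : p < q)
    (hqn : 2 * q ≤ n) {i : ℕ} (hi : i < m) : L i ≠ 0 := by
  have eval_pos : 0 < eval (1 : ℤ) 1 1 (L i) := by
    refine h.eval_below.pos hp (by omega) (by omega) (by omega) one_pos one_pos (fun j hj => ?_)
      i hi
    rw [h.eval_init ⟨j, hj⟩]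
    exact one_pos
  exact fun h0 => eval_pos.ne' (by rw [h0, map_zero])

theorem prime_apply_n (h : IsGenericGaleRobinson n p q m L) (hp : 0 < p) (hpq : p < q)
    (hqn : 2 * q ≤ n) (hm : n < m) : Prime (L n) := by
  let x (i : ℕ) (hi : i < n) : Multiplicative (Fin n → ℤ) := .ofAdd (Pi.single ⟨i, hi⟩ 1)
  have L_eq {i : ℕ} (hi : i < n) : L i = monomial (x i hi) := h.init ⟨i, hi⟩
  let d := x p (by omega) * x (n - p) (by omega)
  let e := d⁻¹ * (x q (by omega) * x (n - q) (by omega))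
  have h_n : L n * monomial (x 0 (by omega)) =
      (param n 0 + param n 1 * monomial e) * monomial d := by
    rw [← L_eq, h.below.mul_eq 0 (l := n) (i := p) (j := n - p) (i' := q) (j' := n - q)
      (by omega) (by omega) (by omega) (by omega) (by omega) (by omega),
      L_eq (i := p) (by omega), L_eq (i := n - p) (by omega), L_eq (i := q) (by omega),
      L_eq (i := n - q) (by omega), add_mul, mul_assoc _ (monomial e : Λ n), ← Units.val_mul,
      ← map_mul, inv_mul_cancel_comm]
    simp only [d, map_mul, Units.val_mul]
    ring
  have h_assoc : Associated (L n) (param n 0 + param n 1 * monomial e) :=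
    ⟨monomial (x 0 (by omega)) * (monomial d)⁻¹, by
      rw [Units.val_mul, ← mul_assoc, h_n, Units.mul_inv_cancel_right]⟩
  exact h_assoc.symm.prime (prime_param_add_param_mul_monomial e)

theorem mul_eq_galeRobinsonCofactor (h : IsGenericGaleRobinson n p q m L) (hp : 0 < p)
    (hpq : p < q) (hqn : 2 * q ≤ n) (hm : 2 * n < m) :
    L (2 * n) * (L p * L (n - p) * (L q * L (n - q))) =
      galeRobinsonCofactor n p q (param n 0) (param n 1) L := by
  refine mul_right_cancel₀ (h.ne_zero hp hpq hqn (i := n) (by omega)) ?_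
  have h_two_n := h.below n (by omega)
  rw [← two_mul] at h_two_n
  rw [mul_right_comm, h_two_n, h.below.galeRobinsonNum_mul_eq hm.le hp hpq hqn, mul_comm]

theorem not_apply_n_dvd_apply (h : IsGenericGaleRobinson n p q m L) (hp : 0 < p) (hpq : p < q)
    (hqn : 2 * q ≤ n) (hm : 2 * n < m) {i : ℕ} (hni : n < i) (hi : i ≤ 2 * n) : ¬ L n ∣ L i := by
  let f : Λ n →+* ℚ := eval 1 2 fun i : Fin n =>
    Units.mk0 (if (i : ℕ) = p then -2 else 1) (by split_ifs <;> norm_num)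
  have hf : GaleRobinsonBelow n p q (2 * n) 1 2 fun i => f (L i) := h.eval_below.mono hm.le
  have f_init (i : ℕ) (hi : i < n) : f (L i) = if i = p then -2 else 1 := h.eval_init ⟨i, hi⟩
  suffices f_ne_zero : f (L i) ≠ 0 by
    intro hdvd
    have f_dvd := map_dvd f hdvd
    rw [hf.apply_n_eq_zero hp hpq hqn f_init, zero_dvd_iff] at f_dvd
    exact f_ne_zero f_dvd
  obtain hi | rfl := hi.lt_or_eq
  · exact hf.apply_ne_zero hp hpq hqn f_init hni hi
  · have h_cof := congrArg f (h.mul_eq_galeRobinsonCofactor hp hpq hqn hm)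
    rw [map_galeRobinsonCofactor, eval_param, eval_param, map_mul] at h_cof
    exact left_ne_zero_of_mul
      (h_cof.trans_ne (hf.galeRobinsonCofactor_ne_zero hp hpq hqn f_init))

/-- Once the window `L_s, …, L_{s+n-1}` consists of units, `L_{s+i}` is the value of the Laurent
polynomial `L_i` at this window, and the recurrence for `L` at `k - s` evaluates to the claim. -/
theorem exists_mem_dvd_mul_galeRobinsonNum (h : IsGenericGaleRobinson n p q (k + n) L)
    (hp : 0 < p) (hpq : p < q) (hqn : 2 * q ≤ n) {M : Submonoid (Λ n)}
    (hM : M ≤ nonZeroDivisors (Λ n)) {s : ℕ} (hs : 0 < s) (hsk : s ≤ k)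
    (hunit : ∀ j : Fin n, IsUnit (algebraMap (Λ n) (Localization M) (L (s + j)))) :
    ∃ t ∈ M, L k ∣ t * galeRobinsonNum n p q (param n 0) (param n 1) L k := by
  let ι := algebraMap (Λ n) (Localization M)
  have : IsDomain (Localization M) := IsLocalization.isDomain_localization hM
  have ι_injective : Function.Injective ι := IsLocalization.injective _ hM
  let f : Λ n →+* Localization M :=
    eval (ι (param n 0)) (ι (param n 1)) fun j => (hunit j).unit
  have f_eq : ∀ i < k + n - s, f (L i) = ι (L (s + i)) := by
    refine (h.mono (by omega)).eval_eq hp hpq hqn ?_ (fun _ => rfl) fun i hi => ?_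
    · exact (h.below.map ι).shift (by omega) (by omega) s
    · exact (map_ne_zero_iff ι ι_injective).2 (h.ne_zero hp hpq hqn (by omega))
  obtain ⟨k', rfl⟩ := Nat.exists_eq_add_of_le hsk
  have f_below : GaleRobinsonBelow n p q (s + k' + n) (ι (param n 0)) (ι (param n 1))
    fun i => f (L i) := h.eval_below
  have f_rec := f_below k' (by omega)
  rw [galeRobinsonNum_congr hp (by omega) (by omega) (by omega) (fun i hi => f_eq i (by omega)),
    galeRobinsonNum_shift (y := fun i => ι (L i)) (by omega) (by omega), ← map_galeRobinsonNum]
    at f_rec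
  have mem_map : ι (galeRobinsonNum n p q (param n 0) (param n 1) L (s + k')) ∈
      (Ideal.span {L (s + k')}).map ι := by
    rw [← f_rec]
    beta_reduce
    rw [f_eq k' (by omega)]
    exact Ideal.mul_mem_left _ _ (Ideal.mem_map_of_mem _ (Ideal.mem_span_singleton_self _))
  obtain ⟨t, ht, hdvd⟩ := (IsLocalization.algebraMap_mem_map_algebraMap_iff M _ _ _).1 mem_map
  exact ⟨t, ht, Ideal.mem_span_singleton.1 hdvd⟩

theorem dvd_galeRobinsonNum (h : IsGenericGaleRobinson n p q (k + n) L) (hp : 0 < p)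
    (hpq : p < q) (hqn : 2 * q ≤ n) :
    L k ∣ galeRobinsonNum n p q (param n 0) (param n 1) L k := by
  obtain hk | rfl | hk := lt_trichotomy k n
  · exact (h.isUnit hk).dvd
  · have isUnit_init : IsUnit (L p * L (k - p) * (L q * L (k - q))) :=
      ((h.isUnit (by omega)).mul (h.isUnit (by omega))).mul
        ((h.isUnit (by omega)).mul (h.isUnit (by omega)))
    rw [← isUnit_init.dvd_mul_right, h.below.galeRobinsonNum_mul_eq (by omega) hp hpq hqn]
    exact dvd_mul_right _ _
  · have prime_n : Prime (L n) := h.prime_apply_n hp hpq hqn (by omega)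
    have : (Ideal.span {L n}).IsPrime := (Ideal.span_singleton_prime prime_n.ne_zero).2 prime_n
    obtain ⟨t, ⟨j, rfl⟩, ht⟩ := h.exists_mem_dvd_mul_galeRobinsonNum hp hpq hqn (s := 1)
      (powers_le_nonZeroDivisors_of_noZeroDivisors prime_n.ne_zero) one_pos (by omega)
      fun i => by
        obtain hi | hi : 1 + (i : ℕ) < n ∨ 1 + (i : ℕ) = n := by omega
        · exact (h.isUnit hi).map _
        · rw [hi]
          exact IsLocalization.map_units _ (⟨L n, Submonoid.mem_powers _⟩ : Submonoid.powers (L n))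
    obtain ⟨s, hs, hdvd⟩ := h.exists_mem_dvd_mul_galeRobinsonNum hp hpq hqn (s := n + 1)
      (Ideal.primeCompl_le_nonZeroDivisors (Ideal.span {L n})) n.succ_pos hk
      fun i => IsLocalization.map_units _ (⟨L (n + 1 + i), fun hmem =>
        h.not_apply_n_dvd_apply hp hpq hqn (by omega) (by omega) (by omega)
          (Ideal.mem_span_singleton.1 hmem)⟩ : (Ideal.span {L n}).primeCompl)
    exact dvd_of_dvd_prime_pow_mul_of_dvd_mul prime_n
      (fun h => hs (Ideal.mem_span_singleton.2 h)) ht hdvd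

end IsGenericGaleRobinson

theorem exists_isGenericGaleRobinson {n p q : ℕ} (hp : 0 < p) (hpq : p < q) (hqn : 2 * q ≤ n)
    (k : ℕ) : ∃ L : ℕ → Λ n, IsGenericGaleRobinson n p q (k + n) L := by
  induction k with
  | zero =>
    exact ⟨fun i => if hi : i < n then var ⟨i, hi⟩ else 0, fun i => by simp, fun k hk => by omega⟩
  | succ k ih =>
    obtain ⟨L, hL⟩ := ih
    obtain ⟨c, hc⟩ := hL.dvd_galeRobinsonNum hp hpq hqn
    refine ⟨Function.update L (k + n) c, fun i => ?_, ?_⟩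
    · rw [Function.update_of_ne (by omega), hL.init]
    · rw [Nat.succ_add]
      exact hL.below.update hp (by omega) (by omega) (by omega) rfl (by rw [hc, mul_comm])

theorem IsTwoTermGaleRobinson.eq_value {n p q m : ℕ} {L : ℕ → Λ n}
    (hL : IsGenericGaleRobinson n p q m L) (hp : 0 < p) (hpq : p < q) (hqn : 2 * q ≤ n)
    {K : Type*} [Field K] {a b : K} {z : ℕ → K} (hz : ∀ k, z k ≠ 0)
    (h : IsTwoTermGaleRobinson n p q a b z) {i : ℕ} (hi : i < m) :
    z i = (L i).value a b fun i => z i := by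
  rw [← hL.eval_eq hp hpq hqn (x := fun j => Units.mk0 (z j) (hz j)) (h.below fun k _ => hz k)
    (fun _ => rfl) (fun k _ => hz k) i hi]
  exact eval_eq_value _ _ _ _

namespace RatFunField

variable {n : ℕ}

theorem x_ne_zero (i : Fin n) : x i ≠ 0 :=
  (map_ne_zero_iff _ (FaithfulSMul.algebraMap_injective _ _)).2 (MvPolynomial.X_ne_zero _)

theorem eval_comp_ofMvPolynomial :
    (eval (α n) (β n) fun i => Units.mk0 (x i) (x_ne_zero i)).comp (ofMvPolynomial n) =
      algebraMap _ (RatFunField n) := by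
  refine MvPolynomial.ringHom_ext' (Subsingleton.elim _ _) ?_
  rintro (i | i)
  · rw [RingHom.comp_apply, ofMvPolynomial_X, Sum.elim_inl, eval_param]
    fin_cases i <;> rfl
  · rw [RingHom.comp_apply, ofMvPolynomial_X, Sum.elim_inr, eval_var]
    rfl

theorem ofMvPolynomial_injective : Function.Injective (ofMvPolynomial n) := by
  refine Function.Injective.of_comp
    (f := eval (α n) (β n) fun i => Units.mk0 (x i) (x_ne_zero i)) ?_
  rw [← RingHom.coe_comp, eval_comp_ofMvPolynomial]
  exact FaithfulSMul.algebraMap_injective _ _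

theorem eval_injective :
    Function.Injective (eval (α n) (β n) fun i => Units.mk0 (x i) (x_ne_zero i)) := by
  let ι := algebraMap (Λ n) (FractionRing (Λ n))
  have ι_injective : Function.Injective ι := FaithfulSMul.algebraMap_injective _ _
  let ψ : RatFunField n →+* FractionRing (Λ n) :=
    IsFractionRing.lift (g := ι.comp (ofMvPolynomial n)) (ι_injective.comp ofMvPolynomial_injective)
  have ψ_X (i : Fin 2 ⊕ Fin n) :
      ψ (algebraMap _ _ (MvPolynomial.X i)) = ι (Sum.elim (param n) (fun i => (var i : Λ n)) i) :=
    (IsFractionRing.lift_algebraMap _ _).trans (congrArg ι (ofMvPolynomial_X i))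
  have ψ_comp_eval : ψ.comp (eval (α n) (β n) fun i => Units.mk0 (x i) (x_ne_zero i)) = ι := by
    refine ringHom_ext ?_ ?_ fun i => ?_
    · rw [RingHom.comp_apply, eval_param]
      exact ψ_X (.inl 0)
    · rw [RingHom.comp_apply, eval_param]
      exact ψ_X (.inl 1)
    · rw [RingHom.comp_apply, eval_var]
      exact ψ_X (.inr i)
  refine Function.Injective.of_comp (f := ψ) ?_
  rwa [← RingHom.coe_comp, ψ_comp_eval]

end RatFunField

theorem IsTwoTermGaleRobinson.ne_zero {n p q : ℕ} (hp : 0 < p) (hpq : p < q) (hqn : 2 * q ≤ n)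
    {y : ℕ → RatFunField n} (hinit : ∀ i : Fin n, y i = RatFunField.x i)
    (hrec : IsTwoTermGaleRobinson n p q (RatFunField.α n) (RatFunField.β n) y) (m : ℕ) :
    y m ≠ 0 := by
  induction m using Nat.strong_induction_on with
  | _ m ih =>
    obtain ⟨L, hL⟩ := exists_isGenericGaleRobinson hp hpq hqn (m + 1)
    replace hL := hL.mono (Nat.le_add_right (m + 1) n)
    have hne (k : ℕ) (hk : k + n < m + 1) : y k ≠ 0 := ih k (by omega)
    have eval_eq_y := hL.eval_eq hp hpq hqn
      (x := fun i => Units.mk0 (RatFunField.x i) (RatFunField.x_ne_zero i))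
      (hrec.below hne) hinit hne m m.lt_succ_self
    rw [← eval_eq_y]
    exact (map_ne_zero_iff _ RatFunField.eval_injective).2 (hL.ne_zero hp hpq hqn m.lt_succ_self)

theorem theorem1p4 (n p q : ℕ) (hp : 0 < p) (hpq : p < q) (hqn : 2 * q ≤ n)
    (y : ℕ → RatFunField n) (hinit : ∀ i : Fin n, y i = RatFunField.x i)
    (hrec : IsTwoTermGaleRobinson n p q (RatFunField.α n) (RatFunField.β n) y) (m : ℕ) :
    y m ≠ 0 ∧
    ∃ L : LaurentPoly (MvPolynomial (Fin 2) ℤ) n,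
      y m = L.value (RatFunField.α n) (RatFunField.β n) (fun i => RatFunField.x i) ∧
      ∀ (K : Type u) [Field K] (a b : K) (z : ℕ → K), (∀ k, z k ≠ 0) →
        IsTwoTermGaleRobinson n p q a b z → z m = L.value a b (fun i => z i) := by
  have hy := hrec.ne_zero hp hpq hqn hinit
  obtain ⟨L, hL⟩ := exists_isGenericGaleRobinson hp hpq hqn (m + 1)
  have hm : m < m + 1 + n := by omega
  refine ⟨hy m, L m, ?_, fun K _ a b z hz hzrec => hzrec.eq_value hL hp hpq hqn hz hm⟩
  rw [← funext hinit]
  exact hrec.eq_value hL hp hpq hqn hy hm
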